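/- Consider the Gaussian sequence model $Y_i=\mu_i+\xi_i$, $i=1,\dots,n$, with $\xi_1,\dots,\xi_n$ i.i.d. $N(0,\sigma^2)$, $\sigma\ge 0$, and $\mu\in K\subset\mathbb R^n$. With $\|\cdot\|$ the Euclidean norm, let $$R(K,\sigma)=\inf_{\hat\nu}\ \sup_{\mu\in K}\ \mathbb E_\mu\|\hat\nu(Y)-\mu\|^2$$ be the minimax risk, the infimum being over all measurable $\hat\nu:\mathbb R^n\to\mathbb R^n$. For $0\le k\le n$ let $$d_k(K)=\min_{P}\ \max_{\theta\in K}\ \|P\theta-\theta\|$$ be the Kolmogorov width, where $P$ ranges over the linear projections of $\mathbb R^n$ of rank $k$. A set $K\subset\mathbb R^n$ is orthosymmetric if $(x_1,\dots,x_n)\in K$ implies $(\pm x_1,\dots,\pm x_n)\in K$ for all choices of signs, and quadratically convex if $\{(x_1^2,\dots,x_n^2):x\in K\}$ is convex. There are absolute constants $c,C>0$ such that the following holds for every $n$, every $\sigma\ge 0$ and every compact, convex, orthosymmetric, quadratically convex set $K\subset\mathbb R^n$. 1. If $d_0(K)^2>\sigma^2$, there is $k\in\{1,\dots,n\}$ with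 $d_k(K)^2\le (k+1)\sigma^2$ and $d_{k-1}(K)^2>k\sigma^2$; and for every such $k$, $$c\,\min\{(k+1)\sigma^2,\,d_0(K)^2\}\ \le\ R(K,\sigma)\ \le\ C\,\min\{(k+1)\sigma^2,\,d_0(K)^2\}.$$ 2. If $d_0(K)^2\le\sigma^2$, then $c\,d_0(K)^2\le R(K,\sigma)\le C\,d_0(K)^2$. 3. $c\,\operatorname{diam}(K)^2\le d_0(K)^2\le C\,\operatorname{diam}(K)^2$. -/

import Mathlib

open MeasureTheory ProbabilityTheory
open scoped ENNReal

noncomputable section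

/-- The law of the observation `Y = μ + ξ` in the Gaussian sequence model with `n` observations:
the coordinates `Y i ∼ N(μ i, σ²)` are independent. -/
def gaussianSequenceLaw {n : ℕ} (μ : EuclideanSpace ℝ (Fin n)) (σ : ℝ) :
    Measure (EuclideanSpace ℝ (Fin n)) :=
  (Measure.pi fun i : Fin n => gaussianReal (μ i) (Real.toNNReal (σ ^ 2))).map
    (WithLp.toLp 2 : (Fin n → ℝ) → EuclideanSpace ℝ (Fin n))

/-- The minimax risk `inf_ν sup_{μ ∈ K} E_μ ‖ν(Y) - μ‖²`, the infimum being over all measurable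
functions `ν` of the data. It takes values in `[0, ∞]`, as the risk of an estimator may be
infinite. -/
def minimaxRisk {n : ℕ} (K : Set (EuclideanSpace ℝ (Fin n))) (σ : ℝ) : ℝ≥0∞ :=
  ⨅ (ν : EuclideanSpace ℝ (Fin n) → EuclideanSpace ℝ (Fin n)) (_ : Measurable ν),
    ⨆ μ ∈ K, ∫⁻ y, ENNReal.ofReal (‖ν y - μ‖ ^ 2) ∂(gaussianSequenceLaw μ σ)

/-- The Kolmogorov width `d_k(K) = min_P max_{θ ∈ K} ‖P θ - θ‖`, with `P` ranging over the
linear projections (idempotent linear maps) of `ℝⁿ` of rank `k`. It is meant for `k ≤ n`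
and bounded `K`. -/
def kolmogorovWidth {n : ℕ} (k : ℕ) (K : Set (EuclideanSpace ℝ (Fin n))) : ℝ :=
  ⨅ P : {P : EuclideanSpace ℝ (Fin n) →ₗ[ℝ] EuclideanSpace ℝ (Fin n) //
      IsIdempotentElem P ∧ Module.finrank ℝ (LinearMap.range P) = k},
    ⨆ θ : K, ‖P.1 (θ : EuclideanSpace ℝ (Fin n)) - (θ : EuclideanSpace ℝ (Fin n))‖

/-- `K` is stable under all changes of signs of the coordinates. -/
def IsOrthosymmetric {n : ℕ} (K : Set (EuclideanSpace ℝ (Fin n))) : Prop :=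
  ∀ x ∈ K, ∀ s : Fin n → ℝ, (∀ i, s i = 1 ∨ s i = -1) →
    WithLp.toLp 2 (fun i => s i * x i) ∈ K

/-- The set `K² = {x² : x ∈ K}` of entrywise squares is convex. -/
def IsQuadraticallyConvex {n : ℕ} (K : Set (EuclideanSpace ℝ (Fin n))) : Prop :=
  Convex ℝ ((fun (x : EuclideanSpace ℝ (Fin n)) (i : Fin n) => x i ^ 2) '' K)

/-- The minimax risk of `K` at noise level `σ` equals `r`, up to the factors `c` and `C`. -/
def MinimaxRiskWithin {n : ℕ} (c C : ℝ) (K : Set (EuclideanSpace ℝ (Fin n))) (σ r : ℝ) : Prop :=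
  ENNReal.ofReal (c * r) ≤ minimaxRisk K σ ∧ minimaxRisk K σ ≤ ENNReal.ofReal (C * r)

end

/-! Upper bound: projecting the data onto a nearly optimal `k`-dimensional subspace costs squared
bias about `d_k²` plus variance `kσ²`, and the zero estimator costs at most `d_0²`.

Lower bound: a convex orthosymmetric set contains the box spanned by each of its points `x`, so
Assouad's argument on the box with sides `min |x i| σ` gives a risk of order `F(x) = ∑ min (x i ²)
(σ²)` (`le_minimaxRisk_of_mem`). The point `x` is chosen to maximize `∑ x i ² σ² / (x i ² + σ²)`,
the linear minimax risk of its box. In the variables `t i = x i ²` the domain is convex by quadratic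
convexity. The first-order condition then bounds the energy of every point of `K` outside `S = {i |
σ² < x i ²}` by `4 F(x)`, while `|S| σ² ≤ 2 F(x)` (`exists_mem_sum_min_ge`). If `4 F(x) < kσ²`, then
`|S| < k`, and a coordinate subspace of dimension `k - 1` contradicts `d_{k-1}² > kσ²`. -/

/-! ### Gaussian laws and the risk of projection estimators. -/

theorem MeasureTheory.Measure.pi_mono_of_le {ι : Type*} [Fintype ι] {α : ι → Type*}
    [∀ i, MeasurableSpace (α i)] {μ ν : ∀ i, Measure (α i)} [∀ i, SigmaFinite (μ i)]
    (h : ∀ i, μ i ≤ ν i) : Measure.pi μ ≤ Measure.pi ν := by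
  -- The product outer measure is the largest one bounded on boxes by the product of the side
  -- measures, so comparing on boxes suffices.
  have key : (Measure.pi μ).toOuterMeasure ≤
      OuterMeasure.pi fun i => (ν i).toOuterMeasure := by
    rw [OuterMeasure.le_pi]
    intro s _
    exact (Measure.pi_pi μ s).le.trans (Finset.prod_le_prod' fun i _ => h i (s i))
  refine Measure.le_iff.2 fun s hs => ?_
  rw [Measure.pi_def ν, toMeasure_apply _ _ hs]
  exact key s

theorem lintegral_gaussianSequenceLaw {n : ℕ} (μ : EuclideanSpace ℝ (Fin n)) (σ : ℝ)
    {f : EuclideanSpace ℝ (Fin n) → ℝ≥0∞} (hf : Measurable f) :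
    ∫⁻ y, f y ∂(gaussianSequenceLaw μ σ) =
      ∫⁻ x, f (WithLp.toLp 2 x)
        ∂(Measure.pi fun i : Fin n => gaussianReal (μ i) (Real.toNNReal (σ ^ 2))) :=
  lintegral_map hf (by fun_prop)

instance isProbabilityMeasure_gaussianSequenceLaw {n : ℕ} (μ : EuclideanSpace ℝ (Fin n)) (σ : ℝ) :
    IsProbabilityMeasure (gaussianSequenceLaw μ σ) :=
  Measure.isProbabilityMeasure_map (by fun_prop)

/-- A linear functional of the noise has variance `σ² ‖b‖²`. -/
theorem lintegral_inner_sub_sq {n : ℕ} (μ b : EuclideanSpace ℝ (Fin n)) (σ : ℝ) :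
    ∫⁻ y, ENNReal.ofReal (inner ℝ b (y - μ) ^ 2) ∂(gaussianSequenceLaw μ σ) =
      ENNReal.ofReal (σ ^ 2 * ‖b‖ ^ 2) := by
  rw [lintegral_gaussianSequenceLaw _ _ (by fun_prop)]
  set v := Real.toNNReal (σ ^ 2)
  set γ : Fin n → Measure ℝ := fun i => gaussianReal (μ i) v
  have hid : ∀ i, MemLp (fun t : ℝ => t) 2 (γ i) := fun i => memLp_id_gaussianReal' 2 (by simp)
  have hX : ∀ i, MemLp (fun t : ℝ => b i * t) 2 (γ i) := fun i => (hid i).const_mul _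
  have hY : ∀ i, MemLp (fun ω : Fin n → ℝ => b i * ω i) 2 (Measure.pi γ) := fun i =>
    (hX i).comp_measurePreserving (measurePreserving_eval _ i)
  have hmean : (Measure.pi γ)[∑ i, fun ω : Fin n → ℝ => b i * ω i] = ∑ i, b i * μ i := by
    simp only [Finset.sum_apply]
    rw [integral_finsetSum _ fun i _ => (hY i).integrable (by norm_num)]
    refine Finset.sum_congr rfl fun i _ => ?_
    rw [integral_const_mul, integral_comp_eval (μ := γ) (f := fun t : ℝ => t)
      (by fun_prop)]
    simp [γ]
  have hvar := variance_sum_pi hX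
  have hint := (memLp_finsetSum' Finset.univ fun i _ => hY i).ofReal_variance_eq
  rw [evariance_eq_lintegral_ofReal, hmean, hvar] at hint
  have hinner : ∀ x : Fin n → ℝ, inner ℝ b (WithLp.toLp 2 x - μ) =
      (∑ i, fun ω : Fin n → ℝ => b i * ω i) x - ∑ i, b i * μ i := by
    intro x
    simp [PiLp.inner_apply, Finset.sum_apply, ← Finset.sum_sub_distrib]
    exact Finset.sum_congr rfl fun i _ => by ring
  simp_rw [hinner]
  rw [← hint]
  congr 1
  rw [EuclideanSpace.real_norm_sq_eq, Finset.mul_sum]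
  refine Finset.sum_congr rfl fun i _ => ?_
  rw [variance_const_mul]
  have := variance_id_gaussianReal (μ := μ i) (v := v)
  rw [show (fun t : ℝ => t) = id from rfl, this, Real.coe_toNNReal _ (sq_nonneg σ)]
  ring

/-- The risk of the projection estimator onto `U`. -/
theorem lintegral_starProjection_sub {n : ℕ} (U : Submodule ℝ (EuclideanSpace ℝ (Fin n)))
    (μ : EuclideanSpace ℝ (Fin n)) (σ : ℝ) :
    ∫⁻ y, ENNReal.ofReal (‖U.starProjection y - μ‖ ^ 2) ∂(gaussianSequenceLaw μ σ) =
      ENNReal.ofReal (‖U.starProjection μ - μ‖ ^ 2 + Module.finrank ℝ U * σ ^ 2) := by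
  set e := stdOrthonormalBasis ℝ U
  have hsq : ∀ y, ‖U.starProjection y - μ‖ ^ 2 = ‖U.starProjection μ - μ‖ ^ 2 +
      ∑ j, inner ℝ (e j : EuclideanSpace ℝ (Fin n)) (y - μ) ^ 2 := by
    intro y
    have h1 : U.starProjection y - μ =
        U.starProjection (y - μ) + (U.starProjection μ - μ) := by
      rw [map_sub]; abel
    have h2 : inner ℝ (U.starProjection (y - μ)) (U.starProjection μ - μ) = 0 := by
      rw [← neg_sub μ (U.starProjection μ), inner_neg_right, neg_eq_zero]
      exact Submodule.inner_right_of_mem_orthogonal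
        (Submodule.starProjection_apply_mem U _) (Submodule.sub_starProjection_mem_orthogonal μ)
    have h3 : ‖U.starProjection (y - μ)‖ ^ 2 =
        ∑ j, inner ℝ (e j : EuclideanSpace ℝ (Fin n)) (y - μ) ^ 2 := by
      rw [show ‖U.starProjection (y - μ)‖ = ‖U.orthogonalProjectionOnto (y - μ)‖ from rfl,
        ← e.sum_sq_norm_inner_right]
      refine Finset.sum_congr rfl fun j _ => ?_
      rw [Submodule.inner_orthogonalProjectionOnto_eq_of_mem_left, Real.norm_eq_abs, sq_abs]
    rw [h1, norm_add_sq_real, h2, h3]; ring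
  have h4 : ∀ y, ENNReal.ofReal (‖U.starProjection y - μ‖ ^ 2) =
      ENNReal.ofReal (‖U.starProjection μ - μ‖ ^ 2) +
      ∑ j, ENNReal.ofReal (inner ℝ (e j : EuclideanSpace ℝ (Fin n)) (y - μ) ^ 2) := by
    intro y
    rw [hsq y, ENNReal.ofReal_add (by positivity) (by positivity),
      ENNReal.ofReal_sum_of_nonneg fun _ _ => sq_nonneg _]
  rw [lintegral_congr h4, lintegral_add_left measurable_const, lintegral_const, measure_univ, mul_one,
    lintegral_finsetSum _ fun j _ => by fun_prop, ENNReal.ofReal_add (by positivity) (by positivity)]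
  congr 1
  have hn : ∀ j, ‖(e j : EuclideanSpace ℝ (Fin n))‖ = 1 := e.orthonormal.1
  simp_rw [lintegral_inner_sub_sq, hn]
  rw [← ENNReal.ofReal_sum_of_nonneg fun _ _ => by positivity]
  simp

/-! ### Assouad's lower bound on hyperrectangles. -/

/-- The normalization of the common part of the Gaussian laws with small means. -/
noncomputable def gaussianOverlap : ℝ := Real.exp (-2) * 2 / Real.sqrt (2 * Real.pi)

theorem gaussianOverlap_pos : 0 < gaussianOverlap := by
  unfold gaussianOverlap; positivity

/-- For `x` and `a` in `[-σ, σ]` one has `(x - a)² ≤ 4σ²`, so each density is at least `exp (-2) /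
√(2πσ²)` there. This constant on an interval of length `2σ` has mass free of `σ`. -/
theorem exists_le_gaussianReal {σ : ℝ} (hσ : 0 < σ) :
    ∃ ρ : Measure ℝ, IsFiniteMeasure ρ ∧ ρ Set.univ = ENNReal.ofReal gaussianOverlap ∧
      ∀ a : ℝ, |a| ≤ σ → ρ ≤ gaussianReal a (Real.toNNReal (σ ^ 2)) := by
  set v := Real.toNNReal (σ ^ 2)
  have hv : (v : ℝ) = σ ^ 2 := Real.coe_toNNReal _ (sq_nonneg σ)
  have hv0 : v ≠ 0 := by
    intro h; rw [h] at hv; exact (pow_pos hσ 2).ne hv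
  set q : ℝ := (Real.sqrt (2 * Real.pi * v))⁻¹ * Real.exp (-2)
  have hmass : (volume.withDensity
      ((Set.Icc (-σ) σ).indicator fun _ => ENNReal.ofReal q)) Set.univ =
      ENNReal.ofReal gaussianOverlap := by
    rw [withDensity_apply _ MeasurableSet.univ, Measure.restrict_univ,
      lintegral_indicator measurableSet_Icc, lintegral_const, Measure.restrict_apply_univ,
      Real.volume_Icc, ← ENNReal.ofReal_mul (by positivity)]
    congr 1
    simp only [q, gaussianOverlap]
    rw [hv, Real.sqrt_mul (by positivity), Real.sqrt_sq hσ.le]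
    field_simp
    ring
  refine ⟨_, ⟨by rw [hmass]; exact ENNReal.ofReal_lt_top⟩, hmass, fun a ha => ?_⟩
  rw [gaussianReal_of_var_ne_zero _ hv0]
  refine withDensity_mono (Filter.Eventually.of_forall fun x => ?_)
  refine Set.indicator_apply_le' (fun hx => ?_) fun _ => zero_le
  rw [gaussianPDF, gaussianPDFReal]
  refine ENNReal.ofReal_le_ofReal (mul_le_mul_of_nonneg_left (Real.exp_le_exp.2 ?_) (by positivity))
  rw [hv, neg_div, neg_le_neg_iff, div_le_iff₀ (by positivity)]
  have := abs_le.1 ha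
  nlinarith [hx.1, hx.2]

/-- The vertices `(±a_1, …, ±a_n)` of a hyperrectangle. -/
noncomputable def signedPoint {n : ℕ} (a : Fin n → ℝ) (s : Fin n → ℤˣ) :
    EuclideanSpace ℝ (Fin n) :=
  WithLp.toLp 2 fun i => ((s i : ℤ) : ℝ) * a i

/-- The two laws differ only in coordinate `i`. Putting the common minorant `ρ` there gives a
product measure below both, of mass `gaussianOverlap`, on which `(z - a)² + (z + a)² ≥ 2a²`
pointwise. -/
theorem two_mul_le_lintegral_add_lintegral_flip {n : ℕ} {σ : ℝ} (hσ : 0 < σ) {a : Fin n → ℝ}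
    (ha : ∀ i, |a i| ≤ σ) {ν : EuclideanSpace ℝ (Fin n) → EuclideanSpace ℝ (Fin n)}
    (hν : Measurable ν) (s : Fin n → ℤˣ) (i : Fin n) :
    2 * ENNReal.ofReal (gaussianOverlap * a i ^ 2) ≤
      ∫⁻ y, ENNReal.ofReal ((ν y i - signedPoint a s i) ^ 2)
          ∂(gaussianSequenceLaw (signedPoint a s) σ) +
        ∫⁻ y, ENNReal.ofReal ((ν y i - signedPoint a (s * Pi.mulSingle i (-1)) i) ^ 2)
          ∂(gaussianSequenceLaw (signedPoint a (s * Pi.mulSingle i (-1))) σ) := by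
  obtain ⟨ρ, hfin, hmass, hle⟩ := exists_le_gaussianReal hσ
  set s' := s * Pi.mulSingle i (-1)
  set v := Real.toNNReal (σ ^ 2)
  have habs : ∀ (u : Fin n → ℤˣ) j, |signedPoint a u j| = |a j| := by
    intro u j
    rcases Int.units_eq_one_or (u j) with h | h <;> simp [signedPoint, h]
  have hs'i : signedPoint a s' i = -signedPoint a s i := by simp [signedPoint, s']
  have hs'j : ∀ j, j ≠ i → signedPoint a s' j = signedPoint a s j := by
    intro j hj; simp [signedPoint, s', Pi.mulSingle_eq_of_ne hj]
  set q : Fin n → Measure ℝ := fun j => if j = i then ρ else gaussianReal (signedPoint a s j) v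
  have hqi : q i = ρ := if_pos rfl
  have hqj : ∀ j, j ≠ i → q j = gaussianReal (signedPoint a s j) v := fun j hj => if_neg hj
  have hqfin : ∀ j, IsFiniteMeasure (q j) := by
    intro j
    by_cases hj : j = i
    · rw [hj, hqi]; exact hfin
    · rw [hqj j hj]; infer_instance
  have hq : Measure.pi q Set.univ = ENNReal.ofReal gaussianOverlap := by
    rw [Measure.pi_univ, Finset.prod_eq_single i, hqi, hmass]
    · intro j _ hj; rw [hqj j hj, measure_univ]
    · simp
  have hle1 : Measure.pi q ≤ Measure.pi fun j => gaussianReal (signedPoint a s j) v := by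
    refine Measure.pi_mono_of_le fun j => ?_
    by_cases hj : j = i
    · subst hj; rw [hqi]; exact hle _ ((habs s j).trans_le (ha j))
    · rw [hqj j hj]
  have hle2 : Measure.pi q ≤ Measure.pi fun j => gaussianReal (signedPoint a s' j) v := by
    refine Measure.pi_mono_of_le fun j => ?_
    by_cases hj : j = i
    · subst hj; rw [hqi]; exact hle _ ((habs s' j).trans_le (ha j))
    · rw [hqj j hj, hs'j j hj]
  have hm : Measurable fun y => ν y i := by fun_prop
  rw [lintegral_gaussianSequenceLaw _ _ (by fun_prop),
    lintegral_gaussianSequenceLaw _ _ (by fun_prop)]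
  refine le_trans ?_ (add_le_add (lintegral_mono' hle1 le_rfl) (lintegral_mono' hle2 le_rfl))
  rw [← lintegral_add_left (by fun_prop)]
  calc 2 * ENNReal.ofReal (gaussianOverlap * a i ^ 2)
      = ∫⁻ _, ENNReal.ofReal (2 * a i ^ 2) ∂(Measure.pi q) := by
        rw [lintegral_const, hq, ← ENNReal.ofReal_mul (by positivity),
          show (2 : ℝ≥0∞) = ENNReal.ofReal 2 by simp, ← ENNReal.ofReal_mul (by positivity)]
        congr 1; ring
    _ ≤ _ := by
        refine lintegral_mono fun x => ?_
        rw [← ENNReal.ofReal_add (by positivity) (by positivity), hs'i]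
        refine ENNReal.ofReal_le_ofReal ?_
        have h2 : signedPoint a s i ^ 2 = a i ^ 2 := (sq_eq_sq_iff_abs_eq_abs _ _).2 (habs s i)
        nlinarith [sq_nonneg (ν (WithLp.toLp 2 x) i)]

/-- The minimax risk over the vertices of a hyperrectangle, by Assouad's argument. -/
theorem le_minimaxRisk_of_signedPoint_mem {n : ℕ} {σ : ℝ} (hσ : 0 < σ) {a : Fin n → ℝ}
    (ha : ∀ i, |a i| ≤ σ) {K : Set (EuclideanSpace ℝ (Fin n))}
    (hK : ∀ s, signedPoint a s ∈ K) :
    ENNReal.ofReal (gaussianOverlap * ∑ i, a i ^ 2) ≤ minimaxRisk K σ := by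
  refine le_iInf₂ fun ν hν => ?_
  set R := ⨆ μ ∈ K, ∫⁻ y, ENNReal.ofReal (‖ν y - μ‖ ^ 2) ∂(gaussianSequenceLaw μ σ)
  obtain ⟨g, hgdef⟩ : ∃ g : Fin n → (Fin n → ℤˣ) → ℝ≥0∞, ∀ i s, g i s =
      ∫⁻ y, ENNReal.ofReal ((ν y i - signedPoint a s i) ^ 2)
        ∂(gaussianSequenceLaw (signedPoint a s) σ) := ⟨_, fun _ _ => rfl⟩
  have hpair : ∀ i s, 2 * ENNReal.ofReal (gaussianOverlap * a i ^ 2) ≤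
      g i s + g i (s * Pi.mulSingle i (-1)) := by
    intro i s
    rw [hgdef, hgdef]
    exact two_mul_le_lintegral_add_lintegral_flip hσ ha hν s i
  have hR : ∀ s, ∑ i, g i s ≤ R := by
    intro s
    refine le_trans (le_of_eq ?_) (le_iSup₂ (signedPoint a s) (hK s))
    have hm : ∀ i, Measurable fun y => ν y i := fun i => by fun_prop
    simp_rw [hgdef]
    rw [← lintegral_finsetSum _ fun i _ => by have := hm i; fun_prop]
    refine lintegral_congr fun y => ?_
    rw [EuclideanSpace.real_norm_sq_eq, ENNReal.ofReal_sum_of_nonneg fun _ _ => sq_nonneg _]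
    rfl
  obtain ⟨N, hN⟩ : ∃ N : ℝ≥0∞, N = (Fintype.card (Fin n → ℤˣ) : ℕ) := ⟨_, rfl⟩
  have hN0 : N ≠ 0 := hN ▸ Nat.cast_ne_zero.2 Fintype.card_ne_zero
  have hNt : N ≠ ⊤ := hN ▸ ENNReal.natCast_ne_top _
  -- Flipping the sign of coordinate `i` permutes the vertices, so summing the pair bound counts
  -- each risk twice.
  have hg : ∀ i, N * ENNReal.ofReal (gaussianOverlap * a i ^ 2) ≤ ∑ s, g i s := by
    intro i
    have h1 : ∑ s, g i (s * Pi.mulSingle i (-1)) = ∑ s, g i s :=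
      Fintype.sum_equiv (Equiv.mulRight (Pi.mulSingle i (-1))) _ _ fun s => by
        rw [Equiv.coe_mulRight]
    have h2 : N * (2 * ENNReal.ofReal (gaussianOverlap * a i ^ 2)) ≤
        ∑ s, (g i s + g i (s * Pi.mulSingle i (-1))) := by
      have := Finset.sum_le_sum fun (s : Fin n → ℤˣ) (_ : s ∈ Finset.univ) =>
        hpair i s
      rwa [Finset.sum_const, Finset.card_univ, nsmul_eq_mul, ← hN] at this
    rw [Finset.sum_add_distrib, h1, ← two_mul, mul_left_comm] at h2
    exact (ENNReal.mul_le_mul_iff_right (by simp) (by simp)).1 h2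
  refine (ENNReal.mul_le_mul_iff_right hN0 hNt).1 ?_
  calc N * ENNReal.ofReal (gaussianOverlap * ∑ i, a i ^ 2)
      = ∑ i, N * ENNReal.ofReal (gaussianOverlap * a i ^ 2) := by
        rw [Finset.mul_sum, ENNReal.ofReal_sum_of_nonneg
          fun i _ => mul_nonneg gaussianOverlap_pos.le (sq_nonneg _), Finset.mul_sum]
    _ ≤ ∑ i, ∑ s, g i s := Finset.sum_le_sum fun i _ => hg i
    _ = ∑ s, ∑ i, g i s := Finset.sum_comm
    _ ≤ ∑ _s : Fin n → ℤˣ, R := Finset.sum_le_sum fun s _ => hR s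
    _ = N * R := by rw [Finset.sum_const, Finset.card_univ, nsmul_eq_mul, ← hN]

/-- Coordinates are replaced one at a time: the segment from a point to its reflection in coordinate
`j` takes every value of modulus at most `|x j|` there and fixes the others. -/
theorem IsOrthosymmetric.mem_of_abs_le {n : ℕ} {K : Set (EuclideanSpace ℝ (Fin n))}
    (hK : IsOrthosymmetric K) (hconv : Convex ℝ K) {x y : EuclideanSpace ℝ (Fin n)}
    (hx : x ∈ K) (hy : ∀ i, |y i| ≤ |x i|) : y ∈ K := by
  have key : ∀ S : Finset (Fin n),
      (WithLp.toLp 2 fun i => if i ∈ S then y i else x i) ∈ K := by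
    intro S
    induction S using Finset.induction_on with
    | empty => simpa using hx
    | insert j S hj ih =>
      have hflip := hK _ ih (fun i => if i = j then -1 else 1) fun i => by
        by_cases h : i = j <;> simp [h]
      obtain ⟨t, ht0, ht1, ht⟩ : ∃ t : ℝ, 0 ≤ t ∧ t ≤ 1 ∧ t * x j + (1 - t) * (-x j) = y j := by
        by_cases h0 : x j = 0
        · have := hy j
          rw [h0, abs_zero] at this
          exact ⟨0, le_rfl, zero_le_one, by rw [abs_nonpos_iff.1 this, h0]; simp⟩
        · have h1 : |y j / x j| ≤ 1 := by
            rw [abs_div]; exact div_le_one_of_le₀ (hy j) (abs_nonneg _)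
          have := abs_le.1 h1
          refine ⟨(1 + y j / x j) / 2, by linarith, by linarith, ?_⟩
          field_simp; ring
      convert hconv ih hflip ht0 (sub_nonneg.2 ht1) (by ring) using 1
      ext i
      by_cases h : i = j
      · subst h; simp [hj, ← ht]
      · simp only [Finset.mem_insert, h, false_or, PiLp.add_apply, PiLp.smul_apply, smul_eq_mul,
          if_false]
        ring
  simpa using key Finset.univ

/-- The risk over a solid set is at least that of its hyperrectangles. -/
theorem le_minimaxRisk_of_mem {n : ℕ} {K : Set (EuclideanSpace ℝ (Fin n))}
    (hK : IsOrthosymmetric K) (hconv : Convex ℝ K) {σ : ℝ} (hσ : 0 < σ)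
    {x : EuclideanSpace ℝ (Fin n)} (hx : x ∈ K) :
    ENNReal.ofReal (gaussianOverlap * ∑ i, min (x i ^ 2) (σ ^ 2)) ≤ minimaxRisk K σ := by
  have h0 : ∀ i, 0 ≤ min |x i| σ := fun i => le_min (abs_nonneg _) hσ.le
  have h1 : ∀ i, min (x i ^ 2) (σ ^ 2) = min |x i| σ ^ 2 := by
    intro i
    rcases le_total |x i| σ with h | h
    · rw [min_eq_left h, sq_abs, min_eq_left]
      rw [← sq_abs]; exact pow_le_pow_left₀ (abs_nonneg _) h 2
    · rw [min_eq_right h, min_eq_right]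
      rw [← sq_abs (x i)]; exact pow_le_pow_left₀ hσ.le h 2
  simp_rw [h1]
  refine le_minimaxRisk_of_signedPoint_mem hσ (a := fun i => min |x i| σ)
    (fun i => by rw [abs_of_nonneg (h0 i)]; exact min_le_right _ _) fun s => ?_
  refine hK.mem_of_abs_le hconv hx fun i => ?_
  rcases Int.units_eq_one_or (s i) with h | h <;>
    simp [signedPoint, h, abs_of_nonneg (h0 i)]

theorem minimaxRisk_le {n : ℕ} {K : Set (EuclideanSpace ℝ (Fin n))} {σ B : ℝ}
    (U : Submodule ℝ (EuclideanSpace ℝ (Fin n)))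
    (h : ∀ μ ∈ K, ‖U.starProjection μ - μ‖ ^ 2 ≤ B) :
    minimaxRisk K σ ≤ ENNReal.ofReal (B + Module.finrank ℝ U * σ ^ 2) := by
  refine (iInf₂_le (fun y => U.starProjection y) (by fun_prop)).trans
    (iSup₂_le fun μ hμ => ?_)
  rw [lintegral_starProjection_sub]
  exact ENNReal.ofReal_le_ofReal (by linarith [h μ hμ])

/-! ### Kolmogorov widths and the upper bounds. -/

section KolmogorovWidth

variable {n : ℕ} {K : Set (EuclideanSpace ℝ (Fin n))}

theorem kolmogorovWidth_nonneg (k : ℕ) (K : Set (EuclideanSpace ℝ (Fin n))) :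
    0 ≤ kolmogorovWidth k K :=
  Real.iInf_nonneg fun _ => Real.iSup_nonneg fun _ => norm_nonneg _

theorem kolmogorovWidth_le_of_submodule (U : Submodule ℝ (EuclideanSpace ℝ (Fin n))) {r : ℝ}
    (hr : 0 ≤ r) (h : ∀ θ ∈ K, ∃ u ∈ U, ‖θ - u‖ ≤ r) :
    kolmogorovWidth (Module.finrank ℝ U) K ≤ r := by
  have hP : IsIdempotentElem (U.starProjection : EuclideanSpace ℝ (Fin n) →ₗ[ℝ] EuclideanSpace ℝ (Fin n)) := by
    have := U.isIdempotentElem_starProjection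
    ext1 x
    exact DFunLike.congr_fun this.eq x
  have hrange : LinearMap.range (U.starProjection : EuclideanSpace ℝ (Fin n) →ₗ[ℝ] EuclideanSpace ℝ (Fin n)) = U :=
    U.range_starProjection
  refine (ciInf_le ⟨0, ?_⟩ ⟨_, hP, by rw [hrange]⟩).trans (Real.iSup_le (fun θ => ?_) hr)
  · rintro _ ⟨P, rfl⟩
    exact Real.iSup_nonneg fun _ => norm_nonneg _
  · obtain ⟨u, hu, hur⟩ := h θ θ.2
    refine le_trans ?_ hur
    rw [norm_sub_rev]
    refine (Submodule.starProjection_minimal (U := U) (θ : EuclideanSpace ℝ (Fin n))).trans_le ?_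
    exact ciInf_le ⟨0, by rintro _ ⟨_, rfl⟩; exact norm_nonneg _⟩ (⟨u, hu⟩ : U)

/-- The span of the coordinate vectors with index in `S`. -/
noncomputable def coordinateSpan (S : Finset (Fin n)) :
    Submodule ℝ (EuclideanSpace ℝ (Fin n)) :=
  Submodule.span ℝ (Set.range fun i : S => EuclideanSpace.basisFun (Fin n) ℝ i)

theorem finrank_coordinateSpan (S : Finset (Fin n)) :
    Module.finrank ℝ (coordinateSpan S) = S.card := by
  rw [coordinateSpan, finrank_span_eq_card, Fintype.card_coe]
  exact (EuclideanSpace.basisFun (Fin n) ℝ).orthonormal.linearIndependent.comp _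
    Subtype.val_injective

theorem mem_coordinateSpan (S : Finset (Fin n)) (x : EuclideanSpace ℝ (Fin n)) :
    ∑ i ∈ S, x i • EuclideanSpace.basisFun (Fin n) ℝ i ∈ coordinateSpan S :=
  Submodule.sum_mem _ fun i hi => Submodule.smul_mem _ _ (Submodule.subset_span ⟨⟨i, hi⟩, rfl⟩)

theorem norm_sub_coordinateSpan_sq (S : Finset (Fin n)) (x : EuclideanSpace ℝ (Fin n)) :
    ‖x - ∑ i ∈ S, x i • EuclideanSpace.basisFun (Fin n) ℝ i‖ ^ 2 = ∑ i ∈ Sᶜ, x i ^ 2 := by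
  have h : ∀ i, (x - ∑ j ∈ S, x j • EuclideanSpace.basisFun (Fin n) ℝ j) i =
      if i ∈ S then 0 else x i := by
    intro i
    simp only [PiLp.sub_apply, WithLp.ofLp_sum, Finset.sum_apply, PiLp.smul_apply, smul_eq_mul,
      EuclideanSpace.basisFun_apply, PiLp.single_apply, mul_ite, mul_one, mul_zero,
      Finset.sum_ite_eq]
    split_ifs <;> simp
  rw [EuclideanSpace.real_norm_sq_eq, ← Finset.sum_add_sum_compl S,
    Finset.sum_eq_zero, zero_add]
  · refine Finset.sum_congr rfl fun i hi => ?_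
    rw [h, if_neg (Finset.mem_compl.1 hi)]
  · intro i hi; rw [h, if_pos hi]; simp

/-- A projection that attains the Kolmogorov width up to an arbitrarily small loss. -/
theorem exists_submodule_of_kolmogorovWidth_lt (hK : IsCompact K) {k : ℕ} (hk : k ≤ n) {r : ℝ}
    (hr : kolmogorovWidth k K < r) :
    ∃ U : Submodule ℝ (EuclideanSpace ℝ (Fin n)), Module.finrank ℝ U = k ∧
      ∀ θ ∈ K, ‖U.starProjection θ - θ‖ ≤ r := by
  obtain ⟨S, -, hS⟩ := Finset.exists_subset_card_eq
    (s := (Finset.univ : Finset (Fin n))) (n := k) (by simpa using hk)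
  -- An infimum over an empty family is `0` by convention, so a near-minimizer exists only once some
  -- projection of rank `k` does.
  have : Nonempty {P : EuclideanSpace ℝ (Fin n) →ₗ[ℝ] EuclideanSpace ℝ (Fin n) //
      IsIdempotentElem P ∧ Module.finrank ℝ (LinearMap.range P) = k} := by
    refine ⟨⟨((coordinateSpan S).starProjection : EuclideanSpace ℝ (Fin n) →ₗ[ℝ] _), ?_, ?_⟩⟩
    · ext1 x
      exact DFunLike.congr_fun (coordinateSpan S).isIdempotentElem_starProjection.eq x
    · rw [(coordinateSpan S).range_starProjection, finrank_coordinateSpan, hS]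
  obtain ⟨P, hP⟩ := exists_lt_of_ciInf_lt hr
  refine ⟨LinearMap.range P.1, P.2.2, fun θ hθ => ?_⟩
  have hbdd : BddAbove (Set.range fun θ : K =>
      ‖P.1 (θ : EuclideanSpace ℝ (Fin n)) - (θ : EuclideanSpace ℝ (Fin n))‖) := by
    have hc : Continuous fun x : EuclideanSpace ℝ (Fin n) => ‖P.1 x - x‖ :=
      ((LinearMap.continuous_of_finiteDimensional P.1).sub continuous_id).norm
    obtain ⟨M, hM⟩ := (hK.image hc).bddAbove
    exact ⟨M, by rintro _ ⟨t, rfl⟩; exact hM ⟨t, t.2, rfl⟩⟩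
  refine le_trans ?_ ((le_ciSup hbdd ⟨θ, hθ⟩).trans hP.le)
  -- The projection `P` may be oblique; the orthogonal projection onto its range is at least as
  -- close to every `θ`.
  rw [norm_sub_rev, norm_sub_rev (P.1 _)]
  refine (Submodule.starProjection_minimal (U := LinearMap.range P.1) θ).trans_le ?_
  exact ciInf_le ⟨0, by rintro _ ⟨_, rfl⟩; exact norm_nonneg _⟩
    (⟨P.1 θ, θ, rfl⟩ : LinearMap.range P.1)

theorem norm_le_kolmogorovWidth_zero (hK : IsCompact K) {x : EuclideanSpace ℝ (Fin n)}
    (hx : x ∈ K) : ‖x‖ ≤ kolmogorovWidth 0 K := by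
  refine le_of_forall_gt_imp_ge_of_dense fun r hr => ?_
  obtain ⟨U, hU, h⟩ := exists_submodule_of_kolmogorovWidth_lt hK (Nat.zero_le n) hr
  have := h x hx
  rw [Submodule.finrank_eq_zero.1 hU] at this
  simpa using this

theorem kolmogorovWidth_zero_le {r : ℝ} (hr : 0 ≤ r) (h : ∀ x ∈ K, ‖x‖ ≤ r) :
    kolmogorovWidth 0 K ≤ r := by
  have := kolmogorovWidth_le_of_submodule (K := K) ⊥ hr fun θ hθ =>
    ⟨0, Submodule.zero_mem _, by simpa using h θ hθ⟩
  simpa using this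

theorem kolmogorovWidth_self (K : Set (EuclideanSpace ℝ (Fin n))) : kolmogorovWidth n K = 0 := by
  have := kolmogorovWidth_le_of_submodule (K := K) ⊤ le_rfl fun θ _ =>
    ⟨θ, Submodule.mem_top, by simp⟩
  rw [finrank_top, finrank_euclideanSpace_fin] at this
  exact this.antisymm (kolmogorovWidth_nonneg _ _)

theorem minimaxRisk_le_width_zero (hK : IsCompact K) (σ : ℝ) :
    minimaxRisk K σ ≤ ENNReal.ofReal (kolmogorovWidth 0 K ^ 2) := by
  have := minimaxRisk_le (σ := σ) (B := kolmogorovWidth 0 K ^ 2) ⊥ fun μ (hμ : μ ∈ K) => by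
    simpa using pow_le_pow_left₀ (norm_nonneg _) (norm_le_kolmogorovWidth_zero hK hμ) 2
  simpa using this

theorem minimaxRisk_le_of_width_le (hK : IsCompact K) {σ : ℝ} (hσ : 0 ≤ σ) {k : ℕ} (hk : k ≤ n)
    (h : kolmogorovWidth k K ^ 2 ≤ (k + 1) * σ ^ 2) :
    minimaxRisk K σ ≤ ENNReal.ofReal (4 * ((k + 1) * σ ^ 2)) := by
  -- Without noise the data are the mean, and the identity has zero risk. For `σ > 0` the factor `2`
  -- leaves room for a near-minimizer; bias `2(k+1)σ²` and variance `kσ²` fit into `4(k+1)σ²`.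
  rcases hσ.eq_or_lt with rfl | hσ
  · have := minimaxRisk_le (σ := 0) (B := 0) ⊤ fun μ (_ : μ ∈ K) => by
      rw [Submodule.starProjection_eq_self_iff.2 Submodule.mem_top]; simp
    simpa using this
  · have hlt : kolmogorovWidth k K < Real.sqrt (2 * ((k + 1) * σ ^ 2)) := by
      refine Real.lt_sqrt_of_sq_lt (h.trans_lt ?_)
      have : 0 < ((k : ℝ) + 1) * σ ^ 2 := by positivity
      linarith
    obtain ⟨U, hU, hr⟩ := exists_submodule_of_kolmogorovWidth_lt hK hk hlt
    refine (minimaxRisk_le (σ := σ) (B := 2 * ((k + 1) * σ ^ 2)) U fun μ hμ => ?_).trans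
      (ENNReal.ofReal_le_ofReal ?_)
    · rw [← Real.sq_sqrt (show 0 ≤ 2 * (((k : ℝ) + 1) * σ ^ 2) by positivity)]
      exact pow_le_pow_left₀ (norm_nonneg _) (hr μ hμ) 2
    · rw [hU]; nlinarith [sq_nonneg σ]

/-! ### The hardest hyperrectangle and the lower bounds. -/

/-- The first-order condition at a maximizer of the risk of the best linear estimator. -/
theorem sum_sub_div_sq_nonpos_of_isMaxOn {ι : Type*} [Fintype ι] {T : Set (ι → ℝ)}
    (hT : Convex ℝ T) (hT0 : ∀ t ∈ T, ∀ i, 0 ≤ t i) {v : ℝ} (hv : 0 < v) {s t : ι → ℝ}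
    (hs : s ∈ T) (ht : t ∈ T) (hmax : IsMaxOn (fun t => ∑ i, t i * v / (t i + v)) T s) :
    ∑ i, (t i - s i) / (s i + v) ^ 2 ≤ 0 := by
  have hpos : ∀ u ∈ T, ∀ i, 0 < u i + v := fun u hu i => by linarith [hT0 u hu i]
  have hmem : ∀ ε : ℝ, 0 < ε → ε ≤ 1 → (fun i => s i + ε * (t i - s i)) ∈ T := by
    intro ε h0 h1
    convert hT hs ht (sub_nonneg.2 h1) h0.le (by ring) using 1
    ext i; simp; ring
  have hle : ∀ ε : ℝ, 0 < ε → ε ≤ 1 →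
      ∑ i, (t i - s i) / ((s i + v) * (s i + ε * (t i - s i) + v)) ≤ 0 := by
    intro ε h0 h1
    have h := hmax (hmem ε h0 h1)
    simp only [Set.mem_ofPred_eq] at h
    rw [← sub_nonpos, ← Finset.sum_sub_distrib] at h
    -- The increment along the segment factors exactly; dividing by `v² ε` and letting `ε → 0` gives
    -- the directional derivative up to the factor `v²`.
    have heq : ∑ i, ((s i + ε * (t i - s i)) * v / (s i + ε * (t i - s i) + v) -
        s i * v / (s i + v)) = (v ^ 2 * ε) *
        ∑ i, (t i - s i) / ((s i + v) * (s i + ε * (t i - s i) + v)) := by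
      rw [Finset.mul_sum]
      refine Finset.sum_congr rfl fun i _ => ?_
      have h2 := (hpos _ hs i).ne'
      have h3 := (hpos _ (hmem ε h0 h1) i).ne'
      field_simp
      ring
    rw [heq] at h
    exact nonpos_of_mul_nonpos_right h (by positivity)
  have hlim : Filter.Tendsto
      (fun ε : ℝ => ∑ i, (t i - s i) / ((s i + v) * (s i + ε * (t i - s i) + v)))
      (nhdsWithin 0 (Set.Ioi 0)) (nhds (∑ i, (t i - s i) / (s i + v) ^ 2)) := by
    refine tendsto_nhdsWithin_of_tendsto_nhds (tendsto_finsetSum _ fun i _ => ?_)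
    have h2 := (hpos _ hs i).ne'
    have hc : ContinuousAt
        (fun ε : ℝ => (t i - s i) / ((s i + v) * (s i + ε * (t i - s i) + v))) 0 :=
      ContinuousAt.div (by fun_prop) (by fun_prop) (by simpa using h2)
    have := hc.tendsto
    simpa [sq] using this
  refine le_of_tendsto hlim ?_
  filter_upwards [Ioc_mem_nhdsGT (zero_lt_one' ℝ)] with ε hε
  exact hle ε hε.1 hε.2

/-- On a quadratically convex set some hyperrectangle is as hard as the complement of a small set
of coordinates is large. -/
theorem exists_mem_sum_min_ge (hK : IsCompact K) (hne : K.Nonempty)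
    (hq : IsQuadraticallyConvex K) {σ : ℝ} (hσ : 0 < σ) :
    ∃ x ∈ K, ∃ S : Finset (Fin n), S.card * σ ^ 2 ≤ 2 * ∑ i, min (x i ^ 2) (σ ^ 2) ∧
      ∀ y ∈ K, ∑ i ∈ Sᶜ, y i ^ 2 ≤ 4 * ∑ i, min (x i ^ 2) (σ ^ 2) := by
  set v := σ ^ 2
  have hv : 0 < v := by positivity
  set T := (fun (x : EuclideanSpace ℝ (Fin n)) (i : Fin n) => x i ^ 2) '' K
  have hT0 : ∀ t ∈ T, ∀ i, 0 ≤ t i := by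
    rintro _ ⟨x, _, rfl⟩ i; exact sq_nonneg _
  have hTc : IsCompact T := hK.image (by fun_prop)
  obtain ⟨s, hs, hmax⟩ := hTc.exists_isMaxOn (hne.image _)
    (f := fun t : Fin n → ℝ => ∑ i, t i * v / (t i + v)) (by
      refine continuousOn_finsetSum _ fun i _ => ContinuousOn.div (by fun_prop) (by fun_prop) ?_
      intro t ht
      linarith [hT0 t ht i])
  have hs0 := hT0 s hs
  obtain ⟨x, hx, hxs⟩ := id hs
  have hxs' : ∀ i, x i ^ 2 = s i := fun i => congrFun hxs i
  have hpos : ∀ i, 0 < s i + v := fun i => by linarith [hs0 i]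
  have hmin : ∀ i, s i * v / (s i + v) ≤ min (s i) v := by
    intro i
    refine le_min ?_ ?_ <;> rw [div_le_iff₀ (hpos i)] <;> nlinarith [hs0 i]
  have hm0 : ∀ i, 0 ≤ min (s i) v := fun i => le_min (hs0 i) hv.le
  refine ⟨x, hx, Finset.univ.filter fun i => v < s i, ?_, fun y hy => ?_⟩ <;>
    simp_rw [hxs']
  · rw [← nsmul_eq_mul, ← Finset.sum_const]
    have h1 : ∑ i ∈ Finset.univ.filter (fun i => v < s i), v ≤ ∑ i, min (s i) v :=
      (Finset.sum_le_sum fun i hi => by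
        rw [min_eq_right (Finset.mem_filter.1 hi).2.le]).trans
        (Finset.sum_le_sum_of_subset_of_nonneg (Finset.subset_univ _) fun i _ _ => hm0 i)
    have h2 : 0 ≤ ∑ i, min (s i) v := Finset.sum_nonneg fun i _ => hm0 i
    linarith
  · have h1 := sum_sub_div_sq_nonpos_of_isMaxOn hq hT0 hv hs
      (t := fun i => y i ^ 2) ⟨y, hy, rfl⟩ hmax
    simp_rw [sub_div] at h1
    rw [Finset.sum_sub_distrib, sub_nonpos] at h1
    -- Here one factor `s i + v` of the denominator is bounded below by `v`.
    have h2 : ∑ i, s i / (s i + v) ^ 2 ≤ (∑ i, min (s i) v) / v ^ 2 := by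
      rw [Finset.sum_div]
      refine Finset.sum_le_sum fun i _ => le_trans ?_
        (div_le_div_of_nonneg_right (hmin i) (sq_nonneg v))
      rw [div_div, div_le_div_iff₀ (pow_pos (hpos i) 2) (mul_pos (hpos i) (pow_pos hv 2))]
      nlinarith [mul_nonneg (mul_nonneg (mul_nonneg (hs0 i) (hs0 i)) hv.le) (hpos i).le]
    -- Off `S` one has `s i + v ≤ 2v`, which is the source of the constant `4`.
    have h3 : (∑ i ∈ (Finset.univ.filter fun i => v < s i)ᶜ, y i ^ 2) / (4 * v ^ 2) ≤
        ∑ i, y i ^ 2 / (s i + v) ^ 2 := by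
      rw [Finset.sum_div]
      refine le_trans (Finset.sum_le_sum fun i hi => ?_)
        (Finset.sum_le_sum_of_subset_of_nonneg (Finset.subset_univ _) fun i _ _ => by positivity)
      have hi' : s i ≤ v := by simpa using hi
      refine div_le_div_of_nonneg_left (sq_nonneg _) (pow_pos (hpos i) 2) ?_
      nlinarith [hs0 i]
    have h4 := h3.trans (h1.trans h2)
    rw [div_le_div_iff₀ (by positivity) (by positivity)] at h4
    have : 0 < v ^ 2 := by positivity
    nlinarith

theorem le_minimaxRisk_of_lt_width (hK : IsCompact K) (hconv : Convex ℝ K)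
    (ho : IsOrthosymmetric K) (hq : IsQuadraticallyConvex K) {σ : ℝ} (hσ : 0 < σ) {k : ℕ}
    (hk1 : 1 ≤ k) (hk : k ≤ n) (h : k * σ ^ 2 < kolmogorovWidth (k - 1) K ^ 2) :
    ENNReal.ofReal (gaussianOverlap / 8 * ((k + 1) * σ ^ 2)) ≤ minimaxRisk K σ := by
  have hσ2 : 0 < σ ^ 2 := by positivity
  have hk1' : (1 : ℝ) ≤ k := by exact_mod_cast hk1
  have hne : K.Nonempty := by
    by_contra h0
    rw [Set.not_nonempty_iff_eq_empty] at h0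
    subst h0
    have : kolmogorovWidth (k - 1) (∅ : Set (EuclideanSpace ℝ (Fin n))) = 0 := by
      simp [kolmogorovWidth]
    rw [this] at h
    nlinarith
  obtain ⟨x, hx, S, hS, hy⟩ := exists_mem_sum_min_ge hK hne hq hσ
  refine le_trans (ENNReal.ofReal_le_ofReal ?_) (le_minimaxRisk_of_mem ho hconv hσ hx)
  set F := ∑ i, min (x i ^ 2) (σ ^ 2)
  have hF0 : 0 ≤ F := Finset.sum_nonneg fun i _ => le_min (sq_nonneg _) hσ2.le
  suffices hF : k * σ ^ 2 ≤ 4 * F by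
    -- Uses `k + 1 ≤ 2k`, whence the `8` in the constant.
    have : (k + 1) * σ ^ 2 ≤ 8 * F := by nlinarith
    nlinarith [gaussianOverlap_pos]
  by_contra! hF
  have hcard : S.card < k := by
    have : (S.card : ℝ) < k := lt_of_mul_lt_mul_right (by nlinarith) hσ2.le
    exact_mod_cast this
  obtain ⟨S', hSS', hS'⟩ := Finset.exists_superset_card_eq (s := S) (n := k - 1) (by omega)
    (by rw [Fintype.card_fin]; omega)
  have hw := kolmogorovWidth_le_of_submodule (K := K) (coordinateSpan S')
    (Real.sqrt_nonneg (4 * F)) fun θ hθ =>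
      ⟨_, mem_coordinateSpan S' θ, Real.le_sqrt_of_sq_le <| by
        rw [norm_sub_coordinateSpan_sq]
        exact (Finset.sum_le_sum_of_subset_of_nonneg (Finset.compl_subset_compl.2 hSS')
          fun i _ _ => sq_nonneg _).trans (hy θ hθ)⟩
  rw [finrank_coordinateSpan, hS'] at hw
  have := pow_le_pow_left₀ (kolmogorovWidth_nonneg _ _) hw 2
  rw [Real.sq_sqrt (by positivity)] at this
  linarith

/-- A point of largest norm has all coordinates at most `σ` in modulus, so truncation at `σ` changes
nothing and its whole box is used. -/
theorem le_minimaxRisk_of_width_zero_le (hK : IsCompact K) (hconv : Convex ℝ K)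
    (ho : IsOrthosymmetric K) {σ : ℝ} (hσ : 0 ≤ σ) (h : kolmogorovWidth 0 K ^ 2 ≤ σ ^ 2) :
    ENNReal.ofReal (gaussianOverlap * kolmogorovWidth 0 K ^ 2) ≤ minimaxRisk K σ := by
  have hd0 := kolmogorovWidth_nonneg 0 K
  rcases K.eq_empty_or_nonempty with rfl | hne
  · simp [kolmogorovWidth]
  rcases hσ.eq_or_lt with rfl | hσ
  · rw [show kolmogorovWidth 0 K ^ 2 = 0 from le_antisymm (by simpa using h) (sq_nonneg _)]
    simp
  obtain ⟨x, hx, hmax⟩ := hK.exists_isMaxOn hne continuous_norm.continuousOn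
  have hle : kolmogorovWidth 0 K ≤ ‖x‖ := kolmogorovWidth_zero_le (norm_nonneg _) hmax
  have hx2 : ‖x‖ ^ 2 ≤ σ ^ 2 :=
    (pow_le_pow_left₀ (norm_nonneg _) (norm_le_kolmogorovWidth_zero hK hx) 2).trans h
  refine le_trans (ENNReal.ofReal_le_ofReal ?_) (le_minimaxRisk_of_mem ho hconv hσ hx)
  refine mul_le_mul_of_nonneg_left ?_ gaussianOverlap_pos.le
  refine (pow_le_pow_left₀ hd0 hle 2).trans_eq ?_
  rw [EuclideanSpace.real_norm_sq_eq] at hx2 ⊢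
  refine Finset.sum_congr rfl fun i hi => (min_eq_left ?_).symm
  exact (Finset.single_le_sum (f := fun i => x i ^ 2) (fun _ _ => sq_nonneg _) hi).trans hx2

theorem diam_le_two_mul_width_zero (hK : IsCompact K) :
    Metric.diam K ≤ 2 * kolmogorovWidth 0 K := by
  refine Metric.diam_le_of_forall_dist_le (by linarith [kolmogorovWidth_nonneg 0 K])
    fun x hx y hy => ?_
  rw [dist_eq_norm]
  linarith [norm_sub_le x y, norm_le_kolmogorovWidth_zero hK hx,
    norm_le_kolmogorovWidth_zero hK hy]

/-- Orthosymmetry puts `-x` in `K`, at distance `2‖x‖` from `x`. -/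
theorem width_zero_le_diam (hK : IsCompact K) (ho : IsOrthosymmetric K) :
    kolmogorovWidth 0 K ≤ Metric.diam K := by
  refine kolmogorovWidth_zero_le Metric.diam_nonneg fun x hx => ?_
  have hneg : -x ∈ K := by
    convert ho x hx (fun _ => -1) (fun _ => Or.inr rfl) using 1
    ext i; simp
  have := Metric.dist_le_diam_of_mem hK.isBounded hx hneg
  rw [dist_eq_norm, sub_neg_eq_add, ← two_smul ℝ, norm_smul] at this
  norm_num at this
  linarith [norm_nonneg x]

end KolmogorovWidth

/-! ### Assembly of the theorem. -/

theorem mainTheorem7 :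
    ∃ c C : ℝ, 0 < c ∧ 0 < C ∧
      ∀ (n : ℕ) (K : Set (EuclideanSpace ℝ (Fin n))) (σ : ℝ), 0 ≤ σ →
        IsCompact K → Convex ℝ K → IsOrthosymmetric K → IsQuadraticallyConvex K →
          -- the index `k` exists as soon as `d_0(K)² > σ²`
          (σ ^ 2 < kolmogorovWidth 0 K ^ 2 →
            ∃ k : ℕ, 1 ≤ k ∧ k ≤ n ∧ kolmogorovWidth k K ^ 2 ≤ (k + 1) * σ ^ 2 ∧
              k * σ ^ 2 < kolmogorovWidth (k - 1) K ^ 2) ∧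
          -- the rate for every such `k`
          (∀ k : ℕ, 1 ≤ k → k ≤ n → kolmogorovWidth k K ^ 2 ≤ (k + 1) * σ ^ 2 →
            k * σ ^ 2 < kolmogorovWidth (k - 1) K ^ 2 →
              MinimaxRiskWithin c C K σ (min ((k + 1) * σ ^ 2) (kolmogorovWidth 0 K ^ 2))) ∧
          -- the rate when `d_0(K)² ≤ σ²`
          (kolmogorovWidth 0 K ^ 2 ≤ σ ^ 2 →
            MinimaxRiskWithin c C K σ (kolmogorovWidth 0 K ^ 2)) ∧
          -- `d_0(K)²` is the squared diameter up to constants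
          c * Metric.diam K ^ 2 ≤ kolmogorovWidth 0 K ^ 2 ∧
          kolmogorovWidth 0 K ^ 2 ≤ C * Metric.diam K ^ 2 := by
  have hg := gaussianOverlap_pos
  -- The `1 / 4` comes from `diam K ≤ 2 d_0`, and the `4` from the projection estimator.
  refine ⟨min (gaussianOverlap / 8) (1 / 4), 4, by positivity, by norm_num, ?_⟩
  set c := min (gaussianOverlap / 8) (1 / 4)
  have hc0 : 0 < c := by positivity
  have hc1 : c ≤ gaussianOverlap / 8 := min_le_left _ _
  have hc2 : c ≤ 1 / 4 := min_le_right _ _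
  intro n K σ hσ hK hconv ho hq
  have hd0 := kolmogorovWidth_nonneg 0 K
  refine ⟨fun h => ?_, fun k hk1 hk h1 h2 => ⟨?_, ?_⟩, fun h => ⟨?_, ?_⟩, ?_, ?_⟩
  · classical
    have hn : kolmogorovWidth n K ^ 2 ≤ (n + 1) * σ ^ 2 := by
      rw [kolmogorovWidth_self, zero_pow two_ne_zero]; positivity
    -- The least such `k` works: `d_n = 0` makes the set nonempty, `d_0² > σ²` excludes `k = 0`, and
    -- minimality is the strict inequality at `k - 1`.
    have hex : ∃ k : ℕ, kolmogorovWidth k K ^ 2 ≤ (k + 1) * σ ^ 2 :=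
      ⟨n, hn⟩
    have hpos : 1 ≤ Nat.find hex := by
      rw [Nat.one_le_iff_ne_zero]
      intro h0
      have := Nat.find_spec hex
      rw [h0] at this
      norm_num at this
      linarith
    refine ⟨Nat.find hex, hpos, Nat.find_min' hex hn, Nat.find_spec hex, ?_⟩
    have := Nat.find_min hex (Nat.sub_lt hpos one_pos)
    rw [not_le, Nat.cast_sub hpos, Nat.cast_one, sub_add_cancel] at this
    exact this
  -- At `σ = 0` the claimed rate is `0`.
  · rcases hσ.eq_or_lt with rfl | hσ
    · simp [sq_nonneg]
    · refine (ENNReal.ofReal_le_ofReal ?_).trans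
        (le_minimaxRisk_of_lt_width hK hconv ho hq hσ hk1 hk h2)
      exact mul_le_mul hc1 (min_le_left _ _) (by positivity) (by positivity)
  · rcases min_choice (((k : ℝ) + 1) * σ ^ 2) (kolmogorovWidth 0 K ^ 2) with h | h <;> rw [h]
    · exact minimaxRisk_le_of_width_le hK hσ hk h1
    · exact (minimaxRisk_le_width_zero hK σ).trans
        (ENNReal.ofReal_le_ofReal (by linarith [sq_nonneg (kolmogorovWidth 0 K)]))
  · refine (ENNReal.ofReal_le_ofReal ?_).trans
      (le_minimaxRisk_of_width_zero_le hK hconv ho hσ h)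
    exact mul_le_mul_of_nonneg_right (by linarith) (sq_nonneg _)
  · exact (minimaxRisk_le_width_zero hK σ).trans
      (ENNReal.ofReal_le_ofReal (by linarith [sq_nonneg (kolmogorovWidth 0 K)]))
  · have := pow_le_pow_left₀ Metric.diam_nonneg (diam_le_two_mul_width_zero hK) 2
    nlinarith [sq_nonneg (Metric.diam K)]
  · have := pow_le_pow_left₀ hd0 (width_zero_le_diam hK ho) 2
    nlinarith [sq_nonneg (Metric.diam K)]
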